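/- **Programs.** A probabilistic control-flow graph (pCFG) $\mathcal C$ with output space $\mathbb R^m$ consists of a finite set $L$ of locations; $n \ge m$ real-valued program variables, the first $m$ of which are the output variables (we write $\mathbf x^{out}\in\mathbb R^m$ for the projection of a valuation $\mathbf x\in\mathbb R^n$); an initial location $\ell_{init}$ and valuation $\mathbf x_{init}$; a terminal location $\ell_{out}$; and finitely many transitions $\tau$, each with a source location, a probability distribution $Pr_\tau$ on successor locations, a Borel guard $G(\tau)\subseteq\mathbb R^n$, and an update which is either no update, or a deterministic assignment $x_j := u(\mathbf x)$ with $u$ Borel, or the sampling of one variable $x_j$ from a probability distribution on $\mathbb R$. The guards of the transitions leaving any location are pairwise disjoint and cover $\mathbb R^n$, and the only transition leaving $\ell_{out}$ is a self-loop with guard true and no update. Let $\mathrm{Next}(\tau,\mathbf x)$ be the random valuation obtained by applying the update of $\tau$ to $\mathbf x$. The pCFG defines a Markov process $Z_i=(\ell_i,\mathbf X_i)$, $i\ge 0$, started in $(\ell_{init},\mathbf x_{init})$: in state $(\ell,\mathbf x)$, with $\tau$ the unique enabled transition, the next location is sampled from $Pr_\tau$ and, independently, the next valuation from $\mathrm{Next}(\tau,\mathbf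 x)$. Let $\mathbb P$ be its law and $T=\inf\{i\mid \ell_i=\ell_{out}\}\in\mathbb N\cup\{\infty\}$ the termination time. $\mathcal C$ is a.s. terminating if $\mathbb P(T<\infty)=1$; its output distribution $\mu^{\mathcal C}$ is then the law of $\mathbf X_T^{out}$ on $\mathbb R^m$. A state $(\ell',\mathbf x')$ is a successor of $(\ell,\mathbf x)$ if, for the transition $\tau$ enabled at $(\ell,\mathbf x)$, $Pr_\tau(\ell')>0$ and $\mathbf x'$ is a possible result of applying the update of $\tau$ to $\mathbf x$ (for sampling from $\delta$, the possible values are the atoms of $\delta$ if $\delta$ is discrete and the points of its topological support otherwise); a run is an infinite sequence of states that starts in the initial state and in which each state is followed by one of its successors, and the reachable states are those reached from the initial state by finitely many successor steps. An invariant is a set of states $I$ that contains every reachable state; write $\mathbf x\models I(\ell)$ for $(\ell,\mathbf x)\in I$. **UESMs and LESMs.** Let $f:\mathbb R^m\to\mathbb R$ be Borel. A state function $\eta$ assigns to each location $\ell$ a Borel function $\eta(\ell,\cdot):\mathbb R^n\to\mathbb R$. A state function $U_f$ is an upper expectation supermartingale (UESM) for $f$ with respect to an invariant $I$ if $U_f(\ell_{out},\mathbf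 x)=0$ for all $\mathbf x\models I(\ell_{out})$ and, for every transition $\tau$ with source $\ell$ and every $\mathbf x\models I(\ell)\wedge G(\tau)$, with $\mathbf N=\mathrm{Next}(\tau,\mathbf x)$, $$U_f(\ell,\mathbf x)\ \ge\ \sum_{\ell'}Pr_\tau(\ell')\,\mathbb E\big[U_f(\ell',\mathbf N)+f(\mathbf N^{out})\big]-f(\mathbf x^{out}),$$ where the expectations with $Pr_\tau(\ell')>0$ are required to exist and to be finite. A lower expectation submartingale (LESM) $L_f$ is defined in the same way with $\le$ in place of $\ge$. **OST-soundness.** For a state function $\eta$ put $Y_i=\eta(Z_i)+f(\mathbf X_i^{out})$. The triple $(\mathcal C,\eta,f)$ is OST-sound if $\mathbb E|Y_i|<\infty$ for all $i\ge0$ and at least one of the following holds: (C1) $T\le c$ a.s. for some constant $c$; (C2) there is a constant $c$ with $|Y_{\min\{t,T(\rho)\}}(\rho)|\le c$ for all $t\in\mathbb N$ and all runs $\rho$; (C3) $\mathbb E[T]<\infty$, $\mathbb E|Y_0|<\infty$, and there is a constant $c$ such that $\mathbb E[|Y_{t+1}-Y_t|\mid\mathcal F_t]\le c$ a.s. for all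 $t\in\mathbb N$, where $\mathcal F_t=\sigma(Z_0,\dots,Z_t)$; (C4) there are reals $M,c_1,c_2,d$ with $c_2>0$ such that $\mathbb P(T>k)\le c_1e^{-c_2k}$ for all sufficiently large $k$, and $|Y_{k+1}-Y_k|\le M k^d$ a.s. for all $k\ge1$. **Kantorovich distance.** For a metric $d$ on $\mathbb R^m$ and probability measures $\mu_1,\mu_2$ on $\mathbb R^m$ with finite first moments with respect to $d$ (that is, for each $i$ there is $\mathbf x_0$ with $\mathbb E_{\mu_i}[d(\mathbf x_0,\cdot)]<\infty$), let $\mathcal K_d(\mu_1,\mu_2)=\sup_g|\mathbb E_{\mu_1}[g]-\mathbb E_{\mu_2}[g]|$ over all Borel $g:\mathbb R^m\to\mathbb R$ with $|g(\mathbf x)-g(\mathbf y)|\le d(\mathbf x,\mathbf y)$ for all $\mathbf x,\mathbf y$. **Theorem (Soundness of equivalence and similarity refutation).** Let $\mathcal C_1,\mathcal C_2$ be two a.s. terminating pCFGs with the same output space $\mathbb R^m$ (superscripts $1,2$ refer to them), let $f:\mathbb R^m\to\mathbb R$ be Borel, let $U_f$ be a UESM for $f$ in $\mathcal C_1$ (with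 respect to some invariant) such that $(\mathcal C_1,U_f,f)$ is OST-sound, and let $L_f$ be an LESM for $f$ in $\mathcal C_2$ (with respect to some invariant) such that $(\mathcal C_2,L_f,f)$ is OST-sound. Suppose that $$U_f(\ell^1_{init},\mathbf x^1_{init})+f((\mathbf x^1_{init})^{out})<L_f(\ell^2_{init},\mathbf x^2_{init})+f((\mathbf x^2_{init})^{out}).$$ Then $\mu^{\mathcal C_1}\ne\mu^{\mathcal C_2}$, i.e. $\mu^{\mathcal C_1}[B]\neq\mu^{\mathcal C_2}[B]$ for some Borel set $B\subseteq\mathbb R^m$. Moreover, if $d$ is a metric on $\mathbb R^m$ with respect to which $\mu^{\mathcal C_1}$ and $\mu^{\mathcal C_2}$ have finite first moments, and $f$ is $1$-Lipschitz under $d$, then $$\mathcal K_d(\mu^{\mathcal C_1},\mu^{\mathcal C_2})\ \ge\ L_f(\ell^2_{init},\mathbf x^2_{init})+f((\mathbf x^2_{init})^{out})-U_f(\ell^1_{init},\mathbf x^1_{init})-f((\mathbf x^1_{init})^{out}).$$ -/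

import Mathlib

open MeasureTheory ProbabilityTheory Filter
open scoped ENNReal

noncomputable section

/-- The update of a transition over `n` program variables: no update, the deterministic assignment
of a Borel expression to the variable `j`, or sampling of the variable `j` from a probability
distribution on `ℝ`. -/
inductive PUpdate (n : ℕ) : Type where
  | skip : PUpdate n
  | assign (j : Fin n) (u : (Fin n → ℝ) → ℝ) (hu : Measurable u) : PUpdate n
  | sample (j : Fin n) (δ : Measure ℝ) (hδ : IsProbabilityMeasure δ) : PUpdate n

namespace PUpdate

/-- The law of the random vector of successor valuations of `x`. -/
def next {n : ℕ} : PUpdate n → (Fin n → ℝ) → Measure (Fin n → ℝ)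
  | skip, x => Measure.dirac x
  | assign j u _, x => Measure.dirac (Function.update x j (u x))
  | sample j δ _, x => δ.map (fun v => Function.update x j v)

open Classical in
/-- The values that sampling from `δ` can return: the points of positive mass if `δ` is a discrete
distribution, and the topological support of `δ` otherwise. -/
def outcomes (δ : Measure ℝ) : Set ℝ :=
  if δ {v | δ {v} = 0} = 0 then {v | δ {v} ≠ 0} else δ.support

/-- The valuations that can be obtained by applying the update to `x`. -/
def results {n : ℕ} : PUpdate n → (Fin n → ℝ) → Set (Fin n → ℝ)
  | skip, x => {x}
  | assign j u _, x => {Function.update x j (u x)}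
  | sample j δ _, x => (fun v => Function.update x j v) '' outcomes δ

theorem measurable_next {n : ℕ} (up : PUpdate n) : Measurable up.next := by
  cases up with
  | skip => exact Measure.measurable_dirac
  | assign j u hu =>
    refine Measure.measurable_dirac.comp ?_
    refine measurable_pi_lambda _ fun i => ?_
    by_cases h : i = j
    · subst h
      simpa using hu
    · simpa [Function.update_of_ne h] using measurable_pi_apply i
  | sample j δ hδ =>
    have hm : Measurable fun p : (Fin n → ℝ) × ℝ => Function.update p.1 j p.2 := by
      refine measurable_pi_lambda _ fun i => ?_
      by_cases h : i = j
      · subst h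
        simpa using measurable_snd
      · simp only [Function.update_of_ne h]
        exact (measurable_pi_apply i).comp measurable_fst
    refine Measure.measurable_of_measurable_coe _ fun s hs => ?_
    have h1 : ∀ x : Fin n → ℝ, (sample j δ hδ).next x s
        = δ (Prod.mk x ⁻¹' ((fun p : (Fin n → ℝ) × ℝ => Function.update p.1 j p.2) ⁻¹' s)) := by
      intro x
      exact Measure.map_apply (measurable_update x) hs
    simp only [h1]
    exact measurable_measure_prodMk_left (hm hs)

instance isProbabilityMeasure_next {n : ℕ} (up : PUpdate n) (x : Fin n → ℝ) :
    IsProbabilityMeasure (up.next x) := by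
  cases up with
  | skip => exact Measure.dirac.isProbabilityMeasure
  | assign j u hu => exact Measure.dirac.isProbabilityMeasure
  | sample j δ hδ =>
    exact Measure.isProbabilityMeasure_map (measurable_update x).aemeasurable

end PUpdate

/-- A probabilistic control-flow graph whose output valuations range over `ℝ^m`. The program
variables are indexed by `Fin n` and the first `m` of them are the output variables. -/
structure PCFG (m : ℕ) where
  /-- locations -/
  Loc : Type
  [fintypeLoc : Fintype Loc]
  /-- number of program variables -/
  n : ℕ
  hmn : m ≤ n
  initLoc : Loc
  initVal : Fin n → ℝ
  /-- the terminal location -/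
  outLoc : Loc
  /-- (names of) transitions -/
  Trans : Type
  [fintypeTrans : Fintype Trans]
  src : Trans → Loc
  /-- the distribution of the successor location -/
  pr : Trans → PMF Loc
  guard : Trans → Set (Fin n → ℝ)
  measurableSet_guard : ∀ τ, MeasurableSet (guard τ)
  up : Trans → PUpdate n
  guard_exhaustive : ∀ ℓ x, ∃ τ, src τ = ℓ ∧ x ∈ guard τ
  guard_exclusive : ∀ τ τ', τ ≠ τ' → src τ = src τ' → Disjoint (guard τ) (guard τ')
  out_selfLoop : ∃ τ, src τ = outLoc ∧ (∀ τ', src τ' = outLoc → τ' = τ) ∧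
    pr τ = PMF.pure outLoc ∧ guard τ = Set.univ ∧ up τ = PUpdate.skip

namespace PCFG

variable {m : ℕ} (C : PCFG m)

instance : Fintype C.Loc := C.fintypeLoc
instance : Fintype C.Trans := C.fintypeTrans
instance : MeasurableSpace C.Loc := ⊤
instance : DiscreteMeasurableSpace C.Loc := ⟨fun _ => trivial⟩
instance : MeasurableSpace C.Trans := ⊤
instance : DiscreteMeasurableSpace C.Trans := ⟨fun _ => trivial⟩

/-- Variable valuations. -/
abbrev Val : Type := Fin C.n → ℝ

/-- States. -/
abbrev State : Type := C.Loc × C.Val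

/-- Infinite sequences of states. -/
abbrev Path : Type := ℕ → C.State

/-- The initial state. -/
def init : C.State := (C.initLoc, C.initVal)

/-- Projection of a valuation to the output variables. -/
def out (x : C.Val) : Fin m → ℝ := fun i => x (Fin.castLE C.hmn i)

/-- The transition `τ` is enabled at the state `s`. -/
def Enabled (τ : C.Trans) (s : C.State) : Prop := C.src τ = s.1 ∧ s.2 ∈ C.guard τ

theorem exists_enabled (s : C.State) : ∃ τ, C.Enabled τ s := C.guard_exhaustive s.1 s.2

/-- The unique transition enabled at a state. -/
def trans (s : C.State) : C.Trans := (C.exists_enabled s).choose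

theorem enabled_trans (s : C.State) : C.Enabled (C.trans s) s := (C.exists_enabled s).choose_spec

theorem enabled_iff (τ : C.Trans) (s : C.State) : C.Enabled τ s ↔ C.trans s = τ := by
  refine ⟨fun h => ?_, fun h => h ▸ C.enabled_trans s⟩
  by_contra hne
  have h' := C.enabled_trans s
  exact Set.disjoint_left.mp (C.guard_exclusive _ _ hne (h'.1.trans h.1.symm)) h'.2 h.2

/-- `s'` is a successor of `s`. -/
def IsSucc (s s' : C.State) : Prop :=
  ∃ τ, C.Enabled τ s ∧ C.pr τ s'.1 ≠ 0 ∧ s'.2 ∈ (C.up τ).results s.2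

/-- Reachable states. -/
def Reachable (s : C.State) : Prop := Relation.ReflTransGen C.IsSucc C.init s

/-- Runs. -/
def IsRun (ω : C.Path) : Prop := ω 0 = C.init ∧ ∀ i, C.IsSucc (ω i) (ω (i + 1))

theorem measurable_trans : Measurable C.trans := by
  refine measurable_to_countable' fun τ => ?_
  have h : C.trans ⁻¹' {τ} = ({C.src τ} : Set C.Loc) ×ˢ C.guard τ := by
    ext s
    rw [Set.mem_preimage, Set.mem_singleton_iff, ← C.enabled_iff τ s]
    simp [Enabled, Set.mem_prod, eq_comm]
  rw [h]
  exact (MeasurableSet.of_discrete).prod (C.measurableSet_guard τ)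

theorem measurable_transStep (τ : C.Trans) :
    Measurable fun x : C.Val => (C.pr τ).toMeasure.prod ((C.up τ).next x) := by
  let κ : Kernel C.Val C.Val := ⟨(C.up τ).next, (C.up τ).measurable_next⟩
  have : IsMarkovKernel κ := ⟨fun x => (C.up τ).isProbabilityMeasure_next x⟩
  have h : (fun x : C.Val => (C.pr τ).toMeasure.prod ((C.up τ).next x))
      = ⇑(Kernel.const C.Val (C.pr τ).toMeasure ×ₖ κ) := by
    funext x
    rw [Kernel.prod_apply, Kernel.const_apply]
    rfl
  rw [h]
  exact Kernel.measurable _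

theorem measurable_step : Measurable fun s : C.State =>
    (C.pr (C.trans s)).toMeasure.prod ((C.up (C.trans s)).next s.2) := by
  have h : Measurable fun p : C.Trans × C.Val =>
      (C.pr p.1).toMeasure.prod ((C.up p.1).next p.2) :=
    measurable_from_prod_countable_right fun τ => C.measurable_transStep τ
  have h2 : Measurable fun s : C.State => (C.trans s, s.2) :=
    C.measurable_trans.prodMk measurable_snd
  have h3 := Measurable.comp h h2
  simp only [Function.comp_def] at h3
  exact h3

/-- One step of the process: the successor location and the successor valuation are sampled
independently, according to the unique enabled transition. -/
def step : Kernel C.State C.State where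
  toFun s := (C.pr (C.trans s)).toMeasure.prod ((C.up (C.trans s)).next s.2)
  measurable' := C.measurable_step

instance : IsMarkovKernel C.step :=
  ⟨fun s => by
    change IsProbabilityMeasure ((C.pr (C.trans s)).toMeasure.prod ((C.up (C.trans s)).next s.2))
    infer_instance⟩

/-- The law of the Markov process with initial state `C.init` and transition kernel `C.step`, on the
space of all sequences of states (it is carried by the runs). -/
def pathMeasure : Measure C.Path :=
  Kernel.traj (X := fun _ => C.State)
    (fun i => C.step.comap (fun h : (j : Finset.Iic i) → C.State => h ⟨i, Finset.mem_Iic.mpr le_rfl⟩)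
      (measurable_pi_apply _)) 0 (fun _ => C.init)

instance : IsProbabilityMeasure C.pathMeasure := by
  unfold pathMeasure
  infer_instance

/-- The sequence reaches a terminal state. -/
def Terminates (ω : C.Path) : Prop := ∃ i, (ω i).1 = C.outLoc

/-- Almost-sure termination. -/
def ASTerminating : Prop := ∀ᵐ ω ∂C.pathMeasure, C.Terminates ω

/-- The termination time, `⊤` if no terminal state is reached. -/
def timeTerm (ω : C.Path) : ℕ∞ := sInf ((fun i : ℕ => (i : ℕ∞)) '' {i | (ω i).1 = C.outLoc})

/-- The output of a terminating run: the output valuation of the first terminal state (a run never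
leaves this state). -/
def output (ω : C.Path) : Fin m → ℝ := C.out (ω (C.timeTerm ω).toNat).2

theorem timeTerm_le_iff (ω : C.Path) (k : ℕ) :
    C.timeTerm ω ≤ (k : ℕ∞) ↔ ∃ i ≤ k, (ω i).1 = C.outLoc := by
  constructor
  · intro h
    have hne : ((fun i : ℕ => (i : ℕ∞)) '' {i | (ω i).1 = C.outLoc}).Nonempty := by
      by_contra hemp
      rw [Set.not_nonempty_iff_eq_empty] at hemp
      simp [timeTerm, hemp] at h
    obtain ⟨i, hi, hi'⟩ := csInf_mem hne
    refine ⟨i, ?_, hi⟩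
    have h2 : (i : ℕ∞) ≤ k := hi'.le.trans h
    exact_mod_cast h2
  · rintro ⟨i, hik, hi⟩
    have h : C.timeTerm ω ≤ (i : ℕ∞) := sInf_le (Set.mem_image_of_mem _ hi)
    exact h.trans (by exact_mod_cast hik)

theorem measurable_timeTerm : Measurable C.timeTerm := by
  have hloc : ∀ i : ℕ, MeasurableSet {ω : C.Path | (ω i).1 = C.outLoc} := fun i =>
    (measurable_fst.comp (measurable_pi_apply i)) (MeasurableSet.of_discrete (s := {C.outLoc}))
  have hle : ∀ k : ℕ, MeasurableSet {ω | C.timeTerm ω ≤ (k : ℕ∞)} := by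
    intro k
    simp only [timeTerm_le_iff, ← exists_prop, Set.ofPred_exists]
    exact MeasurableSet.iUnion fun i => MeasurableSet.iUnion fun _ => hloc i
  have hcoe : ∀ k : ℕ, MeasurableSet (C.timeTerm ⁻¹' {(k : ℕ∞)}) := by
    intro k
    have h : C.timeTerm ⁻¹' {(k : ℕ∞)} = {ω | C.timeTerm ω ≤ (k : ℕ∞)} \
        ⋃ j : ℕ, ⋃ _ : j < k, {ω | C.timeTerm ω ≤ (j : ℕ∞)} := by
      ext ω
      simp only [Set.mem_preimage, Set.mem_singleton_iff, Set.mem_sdiff, Set.mem_ofPred_eq,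
        Set.mem_iUnion, not_exists, not_le]
      constructor
      · intro h
        rw [h]
        exact ⟨le_rfl, fun j hj => by exact_mod_cast hj⟩
      · rintro ⟨h1, h2⟩
        obtain ⟨t, ht⟩ := ENat.ne_top_iff_exists.mp (ne_top_of_le_ne_top (ENat.natCast_ne_top k) h1)
        rw [← ht] at h1 h2 ⊢
        have h1' : t ≤ k := by exact_mod_cast h1
        by_contra hne
        have hlt : t < k := lt_of_le_of_ne h1' (fun h => hne (by rw [h]))
        exact lt_irrefl _ (h2 t hlt)
    rw [h]
    exact (hle k).diff (MeasurableSet.iUnion fun j => MeasurableSet.iUnion fun _ => hle j)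
  refine measurable_to_countable' fun t => ?_
  induction t using ENat.recTopCoe with
  | coe k => exact hcoe k
  | top =>
    have h : C.timeTerm ⁻¹' {⊤} = (⋃ k : ℕ, C.timeTerm ⁻¹' {(k : ℕ∞)})ᶜ := by
      ext ω
      simp only [Set.mem_preimage, Set.mem_singleton_iff, Set.mem_compl_iff, Set.mem_iUnion]
      rw [← not_iff_not, not_not, ← ne_eq, ENat.ne_top_iff_exists]
      exact exists_congr fun k => eq_comm
    rw [h]
    exact (MeasurableSet.iUnion hcoe).compl

theorem measurable_output : Measurable C.output := by
  have h : Measurable fun p : ℕ × C.Path => C.out (p.2 p.1).2 := by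
    refine measurable_from_prod_countable_right fun i => ?_
    exact measurable_pi_lambda _ fun j =>
      (measurable_pi_apply _).comp (measurable_snd.comp (measurable_pi_apply i))
  exact h.comp (((measurable_of_countable ENat.toNat).comp C.measurable_timeTerm).prodMk
    measurable_id)

/-- The output distribution: the law of the output over the terminating runs. -/
def outputDist : Measure (Fin m → ℝ) :=
  (C.pathMeasure.restrict {ω | C.Terminates ω}).map C.output

/-- State functions. -/
def IsStateFunction (η : C.Loc → C.Val → ℝ) : Prop := ∀ ℓ, Measurable (η ℓ)

/-- The predicate function `I` is an invariant. -/
def IsInvariant (I : C.Loc → Set C.Val) : Prop := ∀ s : C.State, C.Reachable s → s.2 ∈ I s.1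

/-- All the expectations `E[η(ℓ', N) + f(N^out)]`, with `N` the successor valuation of `x` under
`τ` and `ℓ'` a possible successor location, exist. -/
def HasStepExpectation (η : C.Loc → C.Val → ℝ) (f : (Fin m → ℝ) → ℝ) (τ : C.Trans) (x : C.Val) :
    Prop :=
  ∀ ℓ', C.pr τ ℓ' ≠ 0 → Integrable (fun y => η ℓ' y + f (C.out y)) ((C.up τ).next x)

/-- The sum of `Pr(ℓ') * E[η(ℓ', N) + f(N^out)]` over the successor locations `ℓ'`, with `N` the
successor valuation of `x` under `τ`. -/
def stepExpectation (η : C.Loc → C.Val → ℝ) (f : (Fin m → ℝ) → ℝ) (τ : C.Trans) (x : C.Val) : ℝ :=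
  ∑ ℓ', (C.pr τ ℓ').toReal * ∫ y, (η ℓ' y + f (C.out y)) ∂((C.up τ).next x)

/-- Upper expectation supermartingales for `f` with respect to `I`. -/
structure IsUESM (I : C.Loc → Set C.Val) (f : (Fin m → ℝ) → ℝ) (U : C.Loc → C.Val → ℝ) : Prop where
  isStateFunction : C.IsStateFunction U
  zero_on_output : ∀ x ∈ I C.outLoc, U C.outLoc x = 0
  hasStepExpectation : ∀ τ, ∀ x ∈ I (C.src τ), x ∈ C.guard τ → C.HasStepExpectation U f τ x
  expected_decrease : ∀ τ, ∀ x ∈ I (C.src τ), x ∈ C.guard τ →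
    U (C.src τ) x ≥ C.stepExpectation U f τ x - f (C.out x)

/-- Lower expectation submartingales for `f` with respect to `I`. -/
structure IsLESM (I : C.Loc → Set C.Val) (f : (Fin m → ℝ) → ℝ) (L : C.Loc → C.Val → ℝ) : Prop where
  isStateFunction : C.IsStateFunction L
  zero_on_output : ∀ x ∈ I C.outLoc, L C.outLoc x = 0
  hasStepExpectation : ∀ τ, ∀ x ∈ I (C.src τ), x ∈ C.guard τ → C.HasStepExpectation L f τ x
  expected_increase : ∀ τ, ∀ x ∈ I (C.src τ), x ∈ C.guard τ →
    L (C.src τ) x ≤ C.stepExpectation L f τ x - f (C.out x)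

/-- The process `Y_i = η(Z_i) + f(X_i^out)`, where `Z_i` is the `i`-th state and `X_i` its
valuation. -/
def proc (η : C.Loc → C.Val → ℝ) (f : (Fin m → ℝ) → ℝ) (i : ℕ) (ω : C.Path) : ℝ :=
  η (ω i).1 (ω i).2 + f (C.out (ω i).2)

/-- The termination time is almost surely bounded. -/
def CondC1 : Prop := ∃ c : ℕ, ∀ᵐ ω ∂C.pathMeasure, C.timeTerm ω ≤ (c : ℕ∞)

/-- The process is uniformly bounded up to termination. -/
def CondC2 (η : C.Loc → C.Val → ℝ) (f : (Fin m → ℝ) → ℝ) : Prop :=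
  ∃ c : ℝ, ∀ (t : ℕ) (ω : C.Path), C.IsRun ω →
    |C.proc η f (min (t : ℕ∞) (C.timeTerm ω)).toNat ω| ≤ c

/-- Finite expected termination time and uniformly bounded conditional expected steps, with respect
to the canonical filtration. -/
def CondC3 (η : C.Loc → C.Val → ℝ) (f : (Fin m → ℝ) → ℝ) : Prop :=
  (∫⁻ ω, (C.timeTerm ω : ℝ≥0∞) ∂C.pathMeasure) < ⊤ ∧
    Integrable (C.proc η f 0) C.pathMeasure ∧
    ∃ c : ℝ, ∀ t : ℕ, ∀ᵐ ω ∂C.pathMeasure,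
      (C.pathMeasure[fun ω' => |C.proc η f (t + 1) ω' - C.proc η f t ω'|
        | Filtration.piLE (X := fun _ : ℕ => C.State) t]) ω ≤ c

/-- Exponentially decreasing tails of the termination time and polynomially bounded steps. -/
def CondC4 (η : C.Loc → C.Val → ℝ) (f : (Fin m → ℝ) → ℝ) : Prop :=
  ∃ M c₁ c₂ d : ℝ, 0 < c₂ ∧
    (∀ᶠ k : ℕ in atTop,
      C.pathMeasure.real {ω | (k : ℕ∞) < C.timeTerm ω} ≤ c₁ * Real.exp (-c₂ * k)) ∧
    ∀ k : ℕ, 1 ≤ k → ∀ᵐ ω ∂C.pathMeasure,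
      |C.proc η f (k + 1) ω - C.proc η f k ω| ≤ M * (k : ℝ) ^ d

/-- OST-soundness of `(C, η, f)`. -/
def OSTSound (η : C.Loc → C.Val → ℝ) (f : (Fin m → ℝ) → ℝ) : Prop :=
  (∀ i, Integrable (C.proc η f i) C.pathMeasure) ∧
    (C.CondC1 ∨ C.CondC2 η f ∨ C.CondC3 η f ∨ C.CondC4 η f)

end PCFG

/-- Equality of output distributions on all Borel sets. -/
def OutputEquivalent {m : ℕ} (C₁ C₂ : PCFG m) : Prop :=
  ∀ B : Set (Fin m → ℝ), MeasurableSet B → C₁.outputDist B = C₂.outputDist B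

/-- `d` is a metric on `X` (not necessarily compatible with any given topology of `X`). -/
structure IsMetric {X : Type} (d : X → X → ℝ) : Prop where
  eq_iff : ∀ x y, d x y = 0 ↔ x = y
  symm : ∀ x y, d x y = d y x
  triangle : ∀ x y z, d x z ≤ d x y + d y z

/-- `f` is 1-Lipschitz under `d`. -/
def IsOneLipschitz {X : Type} (d : X → X → ℝ) (f : X → ℝ) : Prop := ∀ x y, |f x - f y| ≤ d x y

/-- `μ` has a finite first moment with respect to `d`. -/
def HasFiniteFirstMoment {X : Type} [MeasurableSpace X] (d : X → X → ℝ) (μ : Measure X) : Prop :=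
  ∃ x₀, (∫⁻ x, ENNReal.ofReal (d x₀ x) ∂μ) < ⊤

/-- The Kantorovich distance with respect to `d` of two probability measures with finite first
moments: the supremum of `|E_μ[g] - E_ν[g]|` over the (Borel) functions `g` that are 1-Lipschitz
under `d`. The set is then bounded, and all these expectations exist. -/
def kantorovich {X : Type} [MeasurableSpace X] (d : X → X → ℝ) (μ ν : Measure X) : ℝ :=
  sSup {r | ∃ g : X → ℝ, Measurable g ∧ IsOneLipschitz d g ∧ r = |∫ x, g x ∂μ - ∫ x, g x ∂ν|}

end

/-!
The point is optional stopping. Write `Y i = η (Z i) + f (X i)`. The local condition on a UESM makes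
`E[Y i]` antitone in `i` (monotone for an LESM), because the path measure is carried by the runs and
these visit only reachable states. A run is frozen once it is terminal, so under almost sure
termination `Y i` is eventually equal to `f` of the output. Each of (C1)-(C4) gives the sequence `Y`
an integrable majorant: under (C2) a constant, and otherwise `|Y 0| + ∑ |Y (t + 1) - Y t|`, whose
terms only contribute on `{t < T}`. Dominated convergence then bounds the mean output value of `f`
by `U` from above in the first program and by `L` from below in the second, so `f` itself tells the
two output distributions apart and is a competitor in the Kantorovich supremum.
-/

theorem measurable_measure_singleton {α : Type*} [MeasurableSpace α] [MeasurableEq α]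
    (μ : Measure α) [SFinite μ] : Measurable fun a => μ {a} := by
  convert measurable_measure_prodMk_left (ν := μ) (measurableSet_diagonal (α := α)) using 3 with a
  ext b
  simp [eq_comm]

theorem ae_toMeasure_mem_support {α : Type*} [MeasurableSpace α] [MeasurableSingletonClass α]
    (p : PMF α) : ∀ᵐ a ∂p.toMeasure, a ∈ p.support := by
  rw [← p.restrict_toMeasure_support]
  exact ae_restrict_mem p.support_countable.measurableSet

theorem summable_rpow_mul_exp_neg_mul (d : ℝ) {c : ℝ} (hc : 0 < c) :
    Summable fun k : ℕ => (k : ℝ) ^ d * Real.exp (-c * k) := by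
  refine (Real.summable_pow_mul_exp_neg_nat_mul ⌈d⌉₊ hc).of_norm_bounded_eventually_nat ?_
  filter_upwards [eventually_ge_atTop 1] with k hk
  rw [Real.norm_of_nonneg (by positivity), ← Real.rpow_natCast]
  gcongr
  · exact_mod_cast hk
  · exact Nat.le_ceil d

section TailSum

theorem tsum_indicator_lt (k : ℕ∞) :
    ∑' t : ℕ, {t : ℕ | (t : ℕ∞) < k}.indicator (1 : ℕ → ℝ≥0∞) t = k := by
  rw [← tsum_subtype]
  simp only [Pi.one_apply, ENNReal.tsum_set_one]
  induction k using ENat.recTopCoe with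
  | top => simp [Set.encard_univ]
  | coe k =>
    have hrange : {t : ℕ | (t : ℕ∞) < k} = Finset.range k := by ext t; simp
    rw [hrange, Set.encard_coe_eq_coe_finsetCard, Finset.card_range]

variable {Ω : Type*} [MeasurableSpace Ω] {μ : Measure Ω} {T : Ω → ℕ∞}

theorem tsum_measure_lt (hT : Measurable T) :
    ∑' t : ℕ, μ {ω | (t : ℕ∞) < T ω} = ∫⁻ ω, (T ω : ℝ≥0∞) ∂μ := by
  have hset (t : ℕ) : MeasurableSet {ω | (t : ℕ∞) < T ω} :=
    hT (MeasurableSet.of_discrete (s := Set.Ioi (t : ℕ∞)))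
  calc ∑' t : ℕ, μ {ω | (t : ℕ∞) < T ω}
      = ∑' t : ℕ, ∫⁻ ω, {ω | (t : ℕ∞) < T ω}.indicator 1 ω ∂μ := by
        simp only [lintegral_indicator_one (hset _)]
    _ = ∫⁻ ω, ∑' t : ℕ, {ω | (t : ℕ∞) < T ω}.indicator 1 ω ∂μ :=
        (lintegral_tsum fun t => (measurable_one.indicator (hset t)).aemeasurable).symm
    _ = ∫⁻ ω, (T ω : ℝ≥0∞) ∂μ := lintegral_congr fun ω => tsum_indicator_lt (T ω)

theorem summable_measureReal_lt (hT : Measurable T) (h : ∫⁻ ω, (T ω : ℝ≥0∞) ∂μ ≠ ⊤) :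
    Summable fun t : ℕ => μ.real {ω | (t : ℕ∞) < T ω} :=
  ENNReal.summable_toReal ((tsum_measure_lt hT).trans_ne h)

end TailSum

theorem enorm_le_enorm_zero_add_tsum {E : Type*} [NormedAddCommGroup E] (y : ℕ → E) (t : ℕ) :
    ‖y t‖ₑ ≤ ‖y 0‖ₑ + ∑' i, ‖y (i + 1) - y i‖ₑ := by
  calc ‖y t‖ₑ = ‖y 0 + ∑ i ∈ Finset.range t, (y (i + 1) - y i)‖ₑ := by
        rw [Finset.sum_range_sub, add_sub_cancel]
    _ ≤ ‖y 0‖ₑ + ∑ i ∈ Finset.range t, ‖y (i + 1) - y i‖ₑ :=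
        (enorm_add_le _ _).trans (by gcongr; exact enorm_sum_le _ _)
    _ ≤ ‖y 0‖ₑ + ∑' i, ‖y (i + 1) - y i‖ₑ := by gcongr; exact ENNReal.sum_le_tsum _

/-- The hypothesis of dominated convergence: one integrable function bounds the norms of all terms
of `Y` almost everywhere. The processes of OST-sound triples satisfy it. -/
def HasIntegrableMajorant {Ω E : Type*} [MeasurableSpace Ω] [NormedAddCommGroup E] (Y : ℕ → Ω → E)
    (μ : Measure Ω) : Prop :=
  ∃ F : Ω → ℝ, Integrable F μ ∧ ∀ t, ∀ᵐ ω ∂μ, ‖Y t ω‖ ≤ F ω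

namespace HasIntegrableMajorant

variable {Ω E : Type*} [MeasurableSpace Ω] [NormedAddCommGroup E] {μ : Measure Ω}
  {Y : ℕ → Ω → E} {Z : Ω → E}

theorem of_summable_increments (hY : ∀ t, Integrable (Y t) μ)
    (hsum : Summable fun t => ∫ ω, ‖Y (t + 1) ω - Y t ω‖ ∂μ) : HasIntegrableMajorant Y μ := by
  have hinc (t : ℕ) : Integrable (fun ω => Y (t + 1) ω - Y t ω) μ := (hY (t + 1)).sub (hY t)
  have hincm (t : ℕ) : AEMeasurable (fun ω => ‖Y (t + 1) ω - Y t ω‖ₑ) μ := (hinc t).1.enorm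
  set G : Ω → ℝ≥0∞ := fun ω => ‖Y 0 ω‖ₑ + ∑' t, ‖Y (t + 1) ω - Y t ω‖ₑ
  have hGm : AEMeasurable G μ := (hY 0).1.enorm.add (AEMeasurable.tsum hincm)
  have hGint : ∫⁻ ω, G ω ∂μ ≠ ⊤ := by
    rw [lintegral_add_left' (hY 0).1.enorm, lintegral_tsum hincm]
    refine ENNReal.add_ne_top.2 ⟨(hY 0).2.ne, ?_⟩
    simpa only [ofReal_integral_norm_eq_lintegral_enorm (hinc _)] using hsum.tsum_ofReal_ne_top
  refine ⟨fun ω => (G ω).toReal, integrable_toReal_of_lintegral_ne_top hGm hGint, fun t => ?_⟩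
  filter_upwards [ae_lt_top' hGm hGint] with ω hω
  rw [← toReal_enorm]
  exact ENNReal.toReal_mono hω.ne (enorm_le_enorm_zero_add_tsum (fun i => Y i ω) t)

theorem integrable (h : HasIntegrableMajorant Y μ) {t : ℕ} (hY : AEStronglyMeasurable (Y t) μ) :
    Integrable (Y t) μ := by
  obtain ⟨F, hF, hYF⟩ := h
  exact hF.mono' hY (hYF t)

theorem tendsto_integral [NormedSpace ℝ E] (h : HasIntegrableMajorant Y μ)
    (hY : ∀ t, AEStronglyMeasurable (Y t) μ)
    (hlim : ∀ᵐ ω ∂μ, Tendsto (Y · ω) atTop (nhds (Z ω))) :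
    Tendsto (fun t => ∫ ω, Y t ω ∂μ) atTop (nhds (∫ ω, Z ω ∂μ)) := by
  obtain ⟨F, hF, hYF⟩ := h
  exact tendsto_integral_of_dominated_convergence F hY hF hYF hlim

end HasIntegrableMajorant

theorem map_compProd_eq_map_compProd_comap {α β γ : Type*} [MeasurableSpace α] [MeasurableSpace β]
    [MeasurableSpace γ] {μ : Measure α} [SFinite μ] {κ : Kernel β γ} [IsSFiniteKernel κ]
    {g : α → β} (hg : Measurable g) :
    μ.map g ⊗ₘ κ = (μ ⊗ₘ κ.comap g hg).map (Prod.map g id) := by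
  ext s hs
  rw [Measure.map_apply (hg.prodMap measurable_id) hs,
    Measure.compProd_apply (hg.prodMap measurable_id hs), Measure.compProd_apply hs,
    lintegral_map (Kernel.measurable_kernel_prodMk_left hs) hg]
  rfl

section MarkovChain

variable {E : Type*} [MeasurableSpace E] (κ : Kernel E E) [IsMarkovKernel κ] (x₀ : E)

/-- The law, on sequences of states, of the time-homogeneous Markov chain with transition kernel `κ`
started at `x₀`. `C.pathMeasure` unfolds to `chainMeasure C.step C.init`. -/
noncomputable def chainMeasure : Measure (ℕ → E) :=
  Kernel.traj (X := fun _ => E)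
    (fun i => κ.comap (fun h : (j : Finset.Iic i) → E => h ⟨i, Finset.mem_Iic.mpr le_rfl⟩)
      (measurable_pi_apply _)) 0 (fun _ => x₀)

instance : IsProbabilityMeasure (chainMeasure κ x₀) := by
  unfold chainMeasure
  infer_instance

theorem ae_chainMeasure_zero_eq [MeasurableSingletonClass E] :
    ∀ᵐ ω ∂chainMeasure κ x₀, ω 0 = x₀ := by
  have heval : Measurable fun h : (j : Finset.Iic 0) → E => h ⟨0, Finset.mem_Iic.mpr le_rfl⟩ :=
    measurable_pi_apply _
  have h : ∀ᵐ p ∂(chainMeasure κ x₀).map (Preorder.frestrictLe (π := fun _ => E) 0),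
      p ⟨0, Finset.mem_Iic.mpr le_rfl⟩ = x₀ := by
    rw [chainMeasure, Kernel.traj_map_frestrictLe_apply, Kernel.partialTraj_self, Kernel.id_apply]
    exact (ae_dirac_iff (heval (measurableSet_singleton x₀))).2 rfl
  exact ae_of_ae_map (Preorder.measurable_frestrictLe 0).aemeasurable h

theorem map_consecutive_chainMeasure (i : ℕ) :
    (chainMeasure κ x₀).map (fun ω => (ω i, ω (i + 1)))
      = (chainMeasure κ x₀).map (fun ω => ω i) ⊗ₘ κ := by
  have heval : Measurable fun h : (j : Finset.Iic i) → E => h ⟨i, Finset.mem_Iic.mpr le_rfl⟩ :=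
    measurable_pi_apply _
  have hprefix := Preorder.measurable_frestrictLe (X := fun _ => E) i
  have hcur : (chainMeasure κ x₀).map (fun ω => ω i)
      = ((chainMeasure κ x₀).map (Preorder.frestrictLe (π := fun _ => E) i)).map
        (fun h => h ⟨i, Finset.mem_Iic.mpr le_rfl⟩) := (Measure.map_map heval hprefix).symm
  rw [hcur, map_compProd_eq_map_compProd_comap heval, chainMeasure,
    Kernel.traj_map_frestrictLe_apply, Kernel.partialTraj_compProd_eq_map_traj (Nat.zero_le i),
    Measure.map_map (heval.prodMap measurable_id) (hprefix.prodMk (measurable_pi_apply _))]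
  rfl

variable {κ x₀}

theorem ae_chainMeasure_consecutive {r : E → E → Prop}
    (hr : MeasurableSet {p : E × E | r p.1 p.2}) (h : ∀ x, ∀ᵐ y ∂κ x, r x y) (i : ℕ) :
    ∀ᵐ ω ∂chainMeasure κ x₀, r (ω i) (ω (i + 1)) := by
  have hpair : ∀ᵐ p ∂(chainMeasure κ x₀).map (fun ω => (ω i, ω (i + 1))), r p.1 p.2 := by
    rw [map_consecutive_chainMeasure]
    exact Measure.ae_compProd_of_ae_ae hr (ae_of_all _ h)
  exact ae_of_ae_map ((measurable_pi_apply i).prodMk (measurable_pi_apply _)).aemeasurable hpair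

variable {F : Type*} [NormedAddCommGroup F] {g : E → F} {i : ℕ}

theorem integrable_comp_snd_chainMeasure_compProd (hg : StronglyMeasurable g)
    (hint : Integrable (fun ω => g (ω (i + 1))) (chainMeasure κ x₀)) :
    Integrable (fun p => g p.2) ((chainMeasure κ x₀).map (fun ω => ω i) ⊗ₘ κ) := by
  rw [← map_consecutive_chainMeasure]
  exact (integrable_map_measure (hg.comp_measurable measurable_snd).aestronglyMeasurable
    ((measurable_pi_apply i).prodMk (measurable_pi_apply _)).aemeasurable).2 hint

variable [NormedSpace ℝ F]

theorem integrable_integral_chainMeasure (hg : StronglyMeasurable g)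
    (hint : Integrable (fun ω => g (ω (i + 1))) (chainMeasure κ x₀)) :
    Integrable (fun ω => ∫ y, g y ∂κ (ω i)) (chainMeasure κ x₀) := by
  have hcur : Integrable (fun x => ∫ y, g y ∂κ x) ((chainMeasure κ x₀).map fun ω => ω i) := by
    simpa using (integrable_comp_snd_chainMeasure_compProd hg hint).integral_compProd
  exact (integrable_map_measure hcur.aestronglyMeasurable
    (measurable_pi_apply i).aemeasurable).1 hcur

theorem integral_succ_chainMeasure (hg : StronglyMeasurable g)
    (hint : Integrable (fun ω => g (ω (i + 1))) (chainMeasure κ x₀)) :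
    ∫ ω, g (ω (i + 1)) ∂chainMeasure κ x₀ = ∫ ω, ∫ y, g y ∂κ (ω i) ∂chainMeasure κ x₀ := by
  calc ∫ ω, g (ω (i + 1)) ∂chainMeasure κ x₀
      = ∫ p, g p.2 ∂((chainMeasure κ x₀).map (fun ω => ω i) ⊗ₘ κ) := by
        rw [← map_consecutive_chainMeasure, integral_map
          ((measurable_pi_apply i).prodMk (measurable_pi_apply _)).aemeasurable
          (hg.comp_measurable measurable_snd).aestronglyMeasurable]
    _ = ∫ x, ∫ y, g y ∂κ x ∂(chainMeasure κ x₀).map (fun ω => ω i) :=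
        Measure.integral_compProd (integrable_comp_snd_chainMeasure_compProd hg hint)
    _ = ∫ ω, ∫ y, g y ∂κ (ω i) ∂chainMeasure κ x₀ :=
        integral_map (measurable_pi_apply i).aemeasurable hg.integral_kernel.aestronglyMeasurable

end MarkovChain

namespace PUpdate

variable {n : ℕ}

theorem measurableSet_outcomes (δ : Measure ℝ) [SFinite δ] : MeasurableSet (outcomes δ) := by
  unfold outcomes
  split_ifs
  · exact (measurable_measure_singleton δ (measurableSet_singleton 0)).compl
  · exact Measure.isClosed_support.measurableSet

theorem ae_mem_outcomes (δ : Measure ℝ) : ∀ᵐ v ∂δ, v ∈ outcomes δ := by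
  unfold outcomes
  split_ifs with h
  · rw [ae_iff]
    simpa only [Set.mem_ofPred_eq, not_not] using h
  · exact Measure.support_mem_ae

theorem measurableSet_results (up : PUpdate n) :
    MeasurableSet {p : (Fin n → ℝ) × (Fin n → ℝ) | p.2 ∈ up.results p.1} := by
  have measurable_update_fst (j : Fin n) {g : (Fin n → ℝ) × (Fin n → ℝ) → ℝ} (hg : Measurable g) :
      Measurable fun p : (Fin n → ℝ) × (Fin n → ℝ) => Function.update p.1 j (g p) :=
    measurable_update'.comp (measurable_fst.prodMk hg)
  cases up with
  | skip => exact measurableSet_eq_fun measurable_snd measurable_fst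
  | assign j u hu =>
    exact measurableSet_eq_fun measurable_snd (measurable_update_fst j (hu.comp measurable_fst))
  | sample j δ hδ =>
    have hj : Measurable fun p : (Fin n → ℝ) × (Fin n → ℝ) => p.2 j :=
      (measurable_pi_apply j).comp measurable_snd
    have hresults : {p : (Fin n → ℝ) × (Fin n → ℝ) | p.2 ∈ (sample j δ hδ).results p.1}
        = {p | p.2 = Function.update p.1 j (p.2 j)} ∩ (fun p => p.2 j) ⁻¹' outcomes δ := by
      ext ⟨x, y⟩
      simp only [results, Set.mem_ofPred_eq, Set.mem_inter_iff, Set.mem_preimage, Set.mem_image]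
      constructor
      · rintro ⟨v, hv, rfl⟩
        simpa using hv
      · rintro ⟨hy, hv⟩
        exact ⟨y j, hv, hy.symm⟩
    rw [hresults]
    exact (measurableSet_eq_fun measurable_snd (measurable_update_fst j hj)).inter
      (hj (measurableSet_outcomes δ))

theorem ae_mem_results (up : PUpdate n) (x : Fin n → ℝ) : ∀ᵐ y ∂up.next x, y ∈ up.results x := by
  have hmeas : MeasurableSet {y | y ∈ up.results x} :=
    measurable_prodMk_left up.measurableSet_results
  cases up with
  | skip => exact (ae_dirac_iff hmeas).2 rfl
  | assign j u hu => exact (ae_dirac_iff hmeas).2 rfl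
  | sample j δ hδ =>
    refine (ae_map_iff (measurable_update x).aemeasurable hmeas).2 ?_
    filter_upwards [ae_mem_outcomes δ] with v hv
    exact ⟨v, hv, rfl⟩

end PUpdate

namespace PCFG

variable {m : ℕ}

section Runs

variable (C : PCFG m)

theorem step_apply (s : C.State) :
    C.step s = (C.pr (C.trans s)).toMeasure.prod ((C.up (C.trans s)).next s.2) := rfl

theorem measurableSet_isSucc : MeasurableSet {p : C.State × C.State | C.IsSucc p.1 p.2} := by
  simp only [IsSucc, Set.ofPred_exists]
  refine MeasurableSet.iUnion fun τ => ?_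
  have henabled : MeasurableSet {p : C.State × C.State | C.Enabled τ p.1} := by
    simp only [C.enabled_iff]
    exact (C.measurable_trans.comp measurable_fst) (MeasurableSet.of_discrete (s := {τ}))
  have hloc : MeasurableSet {p : C.State × C.State | C.pr τ p.2.1 ≠ 0} :=
    (measurable_fst.comp measurable_snd) (MeasurableSet.of_discrete (s := {ℓ | C.pr τ ℓ ≠ 0}))
  have hval : MeasurableSet {p : C.State × C.State | p.2.2 ∈ (C.up τ).results p.1.2} :=
    ((measurable_snd.comp measurable_fst).prodMk (measurable_snd.comp measurable_snd))
      (C.up τ).measurableSet_results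
  exact henabled.inter (hloc.inter hval)

theorem ae_isSucc_step (s : C.State) : ∀ᵐ s' ∂C.step s, C.IsSucc s s' := by
  rw [step_apply]
  filter_upwards [
    Measure.quasiMeasurePreserving_fst.ae (ae_toMeasure_mem_support (C.pr (C.trans s))),
    Measure.quasiMeasurePreserving_snd.ae ((C.up (C.trans s)).ae_mem_results s.2)]
    with s' hloc hval
  exact ⟨C.trans s, C.enabled_trans s, hloc, hval⟩

theorem ae_zero_eq_init : ∀ᵐ ω ∂C.pathMeasure, ω 0 = C.init :=
  ae_chainMeasure_zero_eq C.step C.init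

theorem ae_isRun : ∀ᵐ ω ∂C.pathMeasure, C.IsRun ω :=
  C.ae_zero_eq_init.and
    (ae_all_iff.2 (ae_chainMeasure_consecutive C.measurableSet_isSucc C.ae_isSucc_step))

variable {C} {s s' : C.State} {ω : C.Path}

theorem IsRun.reachable (h : C.IsRun ω) (i : ℕ) : C.Reachable (ω i) := by
  induction i with
  | zero => rw [h.1]; exact Relation.ReflTransGen.refl
  | succ i ih => exact ih.tail (h.2 i)

theorem IsSucc.eq_of_out (h : C.IsSucc s s') (hs : s.1 = C.outLoc) : s' = s := by
  obtain ⟨τ, ⟨hτ, -⟩, hpr, hres⟩ := h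
  obtain ⟨τ₀, -, huniq, hpr₀, -, hup₀⟩ := C.out_selfLoop
  obtain rfl := huniq τ (hτ.trans hs)
  rw [hpr₀] at hpr
  rw [hup₀] at hres
  refine Prod.ext ?_ hres
  rw [hs]
  simpa [PMF.pure_apply] using hpr

theorem IsRun.eq_of_out (h : C.IsRun ω) {i j : ℕ} (hi : (ω i).1 = C.outLoc) (hij : i ≤ j) :
    ω j = ω i := by
  induction j, hij using Nat.le_induction with
  | base => rfl
  | succ j _ ih => rw [← ih, (h.2 j).eq_of_out (by rw [ih, hi])]

theorem IsRun.timeTerm_le_iff (h : C.IsRun ω) (k : ℕ) :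
    C.timeTerm ω ≤ k ↔ (ω k).1 = C.outLoc := by
  rw [PCFG.timeTerm_le_iff]
  constructor
  · rintro ⟨i, hik, hi⟩
    rw [h.eq_of_out hi hik, hi]
  · exact fun hk => ⟨k, le_rfl, hk⟩

theorem IsRun.apply_min_timeTerm (h : C.IsRun ω) (t : ℕ) :
    ω (min (t : ℕ∞) (C.timeTerm ω)).toNat = ω t := by
  rcases le_total (t : ℕ∞) (C.timeTerm ω) with hle | hle
  · rw [min_eq_left hle, ENat.toNat_natCast]
  · obtain ⟨k, hk⟩ := ENat.ne_top_iff_exists.1 (ne_top_of_le_ne_top (ENat.natCast_ne_top t) hle)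
    rw [min_eq_right hle, ← hk, ENat.toNat_natCast]
    rw [← hk] at hle
    exact (h.eq_of_out ((h.timeTerm_le_iff k).1 hk.ge) (by exact_mod_cast hle)).symm

theorem IsRun.output_eq (h : C.IsRun ω) {t : ℕ} (ht : (ω t).1 = C.outLoc) :
    C.output ω = C.out (ω t).2 := by
  rw [output, ← h.apply_min_timeTerm t, min_eq_right ((h.timeTerm_le_iff t).2 ht)]

end Runs

variable {C : PCFG m} {η : C.Loc → C.Val → ℝ} {f : (Fin m → ℝ) → ℝ} {I : C.Loc → Set C.Val}

section ExpectedStep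

theorem measurable_out : Measurable C.out := measurable_pi_lambda _ fun _ => measurable_pi_apply _

/-- The function of the current state whose values along a path form the process `C.proc η f`. -/
def augmented (η : C.Loc → C.Val → ℝ) (f : (Fin m → ℝ) → ℝ) (s : C.State) : ℝ :=
  η s.1 s.2 + f (C.out s.2)

theorem IsStateFunction.measurable_augmented (hη : C.IsStateFunction η) (hf : Measurable f) :
    Measurable (augmented η f) :=
  (measurable_from_prod_countable_right (f := fun s : C.State => η s.1 s.2) hη).add
    (hf.comp (measurable_out.comp measurable_snd))

theorem IsStateFunction.measurable_proc (hη : C.IsStateFunction η) (hf : Measurable f) (i : ℕ) :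
    Measurable (C.proc η f i) :=
  (hη.measurable_augmented hf).comp (measurable_pi_apply i)

theorem HasStepExpectation.integrable_step (hη : C.IsStateFunction η) (hf : Measurable f)
    {s : C.State} (hs : C.HasStepExpectation η f (C.trans s) s.2) :
    Integrable (augmented η f) (C.step s) := by
  rw [step_apply, integrable_prod_iff (hη.measurable_augmented hf).aestronglyMeasurable]
  exact ⟨(ae_toMeasure_mem_support _).mono hs, Integrable.of_finite⟩

theorem HasStepExpectation.integral_step (hη : C.IsStateFunction η) (hf : Measurable f)
    {s : C.State} (hs : C.HasStepExpectation η f (C.trans s) s.2) :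
    ∫ s', augmented η f s' ∂C.step s = C.stepExpectation η f (C.trans s) s.2 := by
  have hint := hs.integrable_step hη hf
  rw [step_apply] at hint ⊢
  rw [integral_prod _ hint, PMF.integral_eq_sum]
  rfl

theorem IsUESM.integral_step_le (h : C.IsUESM I f η) (hf : Measurable f) {s : C.State}
    (hs : s.2 ∈ I s.1) : ∫ s', augmented η f s' ∂C.step s ≤ augmented η f s := by
  obtain ⟨hsrc, hguard⟩ := C.enabled_trans s
  have hI : s.2 ∈ I (C.src (C.trans s)) := by rwa [hsrc]
  have hdec := h.expected_decrease _ _ hI hguard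
  rw [hsrc] at hdec
  rw [(h.hasStepExpectation _ _ hI hguard).integral_step h.isStateFunction hf, augmented]
  linarith

theorem IsLESM.le_integral_step (h : C.IsLESM I f η) (hf : Measurable f) {s : C.State}
    (hs : s.2 ∈ I s.1) : augmented η f s ≤ ∫ s', augmented η f s' ∂C.step s := by
  obtain ⟨hsrc, hguard⟩ := C.enabled_trans s
  have hI : s.2 ∈ I (C.src (C.trans s)) := by rwa [hsrc]
  have hinc := h.expected_increase _ _ hI hguard
  rw [hsrc] at hinc
  rw [(h.hasStepExpectation _ _ hI hguard).integral_step h.isStateFunction hf, augmented]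
  linarith

theorem IsStateFunction.integrable_integral_step (hη : C.IsStateFunction η) (hf : Measurable f)
    {i : ℕ} (hint : Integrable (C.proc η f (i + 1)) C.pathMeasure) :
    Integrable (fun ω => ∫ s, augmented η f s ∂C.step (ω i)) C.pathMeasure :=
  integrable_integral_chainMeasure (hη.measurable_augmented hf).stronglyMeasurable hint

theorem IsStateFunction.integral_proc_succ (hη : C.IsStateFunction η) (hf : Measurable f)
    {i : ℕ} (hint : Integrable (C.proc η f (i + 1)) C.pathMeasure) :
    ∫ ω, C.proc η f (i + 1) ω ∂C.pathMeasure
      = ∫ ω, ∫ s, augmented η f s ∂C.step (ω i) ∂C.pathMeasure :=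
  integral_succ_chainMeasure (hη.measurable_augmented hf).stronglyMeasurable hint

theorem IsUESM.antitone_integral_proc (h : C.IsUESM I f η) (hI : C.IsInvariant I)
    (hf : Measurable f) (hint : ∀ i, Integrable (C.proc η f i) C.pathMeasure) :
    Antitone fun i => ∫ ω, C.proc η f i ω ∂C.pathMeasure := by
  refine antitone_nat_of_succ_le fun i => ?_
  rw [h.isStateFunction.integral_proc_succ hf (hint (i + 1))]
  refine integral_mono_ae (h.isStateFunction.integrable_integral_step hf (hint (i + 1))) (hint i) ?_
  filter_upwards [C.ae_isRun] with ω hω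
  exact h.integral_step_le hf (hI _ (hω.reachable i))

theorem IsLESM.monotone_integral_proc (h : C.IsLESM I f η) (hI : C.IsInvariant I)
    (hf : Measurable f) (hint : ∀ i, Integrable (C.proc η f i) C.pathMeasure) :
    Monotone fun i => ∫ ω, C.proc η f i ω ∂C.pathMeasure := by
  refine monotone_nat_of_le_succ fun i => ?_
  rw [h.isStateFunction.integral_proc_succ hf (hint (i + 1))]
  refine integral_mono_ae (hint i) (h.isStateFunction.integrable_integral_step hf (hint (i + 1))) ?_
  filter_upwards [C.ae_isRun] with ω hω
  exact h.le_integral_step hf (hI _ (hω.reachable i))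

theorem integral_proc_zero :
    ∫ ω, C.proc η f 0 ω ∂C.pathMeasure = η C.initLoc C.initVal + f (C.out C.initVal) := by
  have hconst : C.proc η f 0 =ᵐ[C.pathMeasure]
      fun _ => η C.initLoc C.initVal + f (C.out C.initVal) := by
    filter_upwards [C.ae_zero_eq_init] with ω hω
    simp only [proc, hω, init]
  rw [integral_congr_ae hconst, integral_const, probReal_univ, one_smul]

end ExpectedStep

section OptionalStopping

theorem IsRun.proc_succ_eq {ω : C.Path} (h : C.IsRun ω) {t : ℕ} (ht : C.timeTerm ω ≤ t) :
    C.proc η f (t + 1) ω = C.proc η f t ω := by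
  simp only [proc, h.eq_of_out ((h.timeTerm_le_iff t).1 ht) t.le_succ]

theorem integral_abs_proc_sub_eq_setIntegral (t : ℕ) :
    ∫ ω, |C.proc η f (t + 1) ω - C.proc η f t ω| ∂C.pathMeasure
      = ∫ ω in {ω | (t : ℕ∞) < C.timeTerm ω},
        |C.proc η f (t + 1) ω - C.proc η f t ω| ∂C.pathMeasure := by
  refine (setIntegral_eq_integral_of_ae_compl_eq_zero ?_).symm
  filter_upwards [C.ae_isRun] with ω hω hstopped
  rw [hω.proc_succ_eq (not_lt.1 hstopped), sub_self, abs_zero]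

theorem measurableSet_piLE_lt_timeTerm (t : ℕ) :
    MeasurableSet[Filtration.piLE (X := fun _ : ℕ => C.State) t]
      {ω : C.Path | (t : ℕ∞) < C.timeTerm ω} := by
  refine ⟨⋂ i : Set.Iic t, {h | (h i).1 ≠ C.outLoc}, MeasurableSet.iInter fun i =>
    (measurable_fst.comp (measurable_pi_apply i))
      (MeasurableSet.of_discrete (s := {ℓ | ℓ ≠ C.outLoc})), ?_⟩
  ext ω
  simp only [← not_le, timeTerm_le_iff, Set.mem_preimage, Set.mem_iInter, Set.mem_ofPred_eq,
    Subtype.forall, Set.mem_Iic, not_exists, not_and]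
  rfl

theorem CondC1.summable_integral_abs_proc_sub (h : C.CondC1) :
    Summable fun t => ∫ ω, |C.proc η f (t + 1) ω - C.proc η f t ω| ∂C.pathMeasure := by
  obtain ⟨c, hc⟩ := h
  refine summable_of_ne_finset_zero (s := Finset.range c) fun t ht => ?_
  refine integral_eq_zero_of_ae ?_
  filter_upwards [hc, C.ae_isRun] with ω hω hrun
  have hct : c ≤ t := by simpa using ht
  rw [hrun.proc_succ_eq (hω.trans (by exact_mod_cast hct)), sub_self, abs_zero, Pi.zero_apply]

theorem CondC3.summable_integral_abs_proc_sub (h : C.CondC3 η f)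
    (hint : ∀ i, Integrable (C.proc η f i) C.pathMeasure) :
    Summable fun t => ∫ ω, |C.proc η f (t + 1) ω - C.proc η f t ω| ∂C.pathMeasure := by
  obtain ⟨hT, -, c, hc⟩ := h
  refine Summable.of_nonneg_of_le (fun t => integral_nonneg fun ω => abs_nonneg _) (fun t => ?_)
    ((summable_measureReal_lt C.measurable_timeTerm hT.ne).mul_left c)
  have hdiff : Integrable (fun ω => |C.proc η f (t + 1) ω - C.proc η f t ω|) C.pathMeasure :=
    ((hint (t + 1)).sub (hint t)).abs
  set S := {ω | (t : ℕ∞) < C.timeTerm ω}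
  calc ∫ ω, |C.proc η f (t + 1) ω - C.proc η f t ω| ∂C.pathMeasure
      = ∫ ω in S, |C.proc η f (t + 1) ω - C.proc η f t ω| ∂C.pathMeasure :=
        integral_abs_proc_sub_eq_setIntegral t
    _ = ∫ ω in S, (C.pathMeasure[fun ω' => |C.proc η f (t + 1) ω' - C.proc η f t ω'|
          | Filtration.piLE (X := fun _ : ℕ => C.State) t]) ω ∂C.pathMeasure :=
        (setIntegral_condExp (Filtration.piLE.le t) hdiff (measurableSet_piLE_lt_timeTerm t)).symm
    _ ≤ ∫ _ in S, c ∂C.pathMeasure :=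
        setIntegral_mono_ae integrable_condExp.integrableOn (integrable_const c).integrableOn (hc t)
    _ = c * C.pathMeasure.real S := by rw [setIntegral_const, smul_eq_mul, mul_comm]

theorem CondC4.summable_integral_abs_proc_sub (h : C.CondC4 η f)
    (hint : ∀ i, Integrable (C.proc η f i) C.pathMeasure) :
    Summable fun t => ∫ ω, |C.proc η f (t + 1) ω - C.proc η f t ω| ∂C.pathMeasure := by
  obtain ⟨M, c₁, c₂, d, hc₂, htail, hdiff⟩ := h
  refine Summable.of_norm_bounded_eventually_nat
    ((summable_rpow_mul_exp_neg_mul d hc₂).mul_left (|M| * c₁)) ?_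
  filter_upwards [htail, eventually_ge_atTop 1] with k hk hk1
  rw [Real.norm_of_nonneg (integral_nonneg fun ω => abs_nonneg _)]
  set S := {ω | (k : ℕ∞) < C.timeTerm ω}
  calc ∫ ω, |C.proc η f (k + 1) ω - C.proc η f k ω| ∂C.pathMeasure
      = ∫ ω in S, |C.proc η f (k + 1) ω - C.proc η f k ω| ∂C.pathMeasure :=
        integral_abs_proc_sub_eq_setIntegral k
    _ ≤ ∫ _ in S, |M| * (k : ℝ) ^ d ∂C.pathMeasure := by
        refine setIntegral_mono_ae ((hint (k + 1)).sub (hint k)).abs.integrableOn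
          (integrable_const _).integrableOn ?_
        filter_upwards [hdiff k hk1] with ω hω
        exact hω.trans (by gcongr; exact le_abs_self M)
    _ = |M| * (k : ℝ) ^ d * C.pathMeasure.real S := by
        rw [setIntegral_const, smul_eq_mul, mul_comm]
    _ ≤ |M| * (k : ℝ) ^ d * (c₁ * Real.exp (-c₂ * k)) := by gcongr
    _ = |M| * c₁ * ((k : ℝ) ^ d * Real.exp (-c₂ * k)) := by ring

theorem CondC2.hasIntegrableMajorant (h : C.CondC2 η f) :
    HasIntegrableMajorant (C.proc η f) C.pathMeasure := by
  obtain ⟨c, hc⟩ := h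
  refine ⟨fun _ => c, integrable_const c, fun t => ?_⟩
  filter_upwards [C.ae_isRun] with ω hω
  simpa only [proc, hω.apply_min_timeTerm t, Real.norm_eq_abs] using hc t ω hω

theorem OSTSound.hasIntegrableMajorant (h : C.OSTSound η f) :
    HasIntegrableMajorant (C.proc η f) C.pathMeasure := by
  obtain ⟨hint, h1 | h2 | h3 | h4⟩ := h
  · exact .of_summable_increments hint h1.summable_integral_abs_proc_sub
  · exact h2.hasIntegrableMajorant
  · exact .of_summable_increments hint (h3.summable_integral_abs_proc_sub hint)
  · exact .of_summable_increments hint (h4.summable_integral_abs_proc_sub hint)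

theorem ASTerminating.outputDist_eq_map (hterm : C.ASTerminating) :
    C.outputDist = C.pathMeasure.map C.output := by
  rw [outputDist, Measure.restrict_eq_self_of_ae_mem (s := {ω | C.Terminates ω}) hterm]

theorem ASTerminating.isProbabilityMeasure_outputDist (hterm : C.ASTerminating) :
    IsProbabilityMeasure C.outputDist := by
  rw [hterm.outputDist_eq_map]
  exact Measure.isProbabilityMeasure_map C.measurable_output.aemeasurable

theorem ASTerminating.ae_tendsto_proc (hterm : C.ASTerminating) (hI : C.IsInvariant I)
    (hout : ∀ x ∈ I C.outLoc, η C.outLoc x = 0) :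
    ∀ᵐ ω ∂C.pathMeasure, Tendsto (C.proc η f · ω) atTop (nhds (f (C.output ω))) := by
  filter_upwards [hterm, C.ae_isRun] with ω ⟨i, hi⟩ hω
  refine tendsto_const_nhds.congr' ?_
  filter_upwards [eventually_ge_atTop i] with t hit
  have ht : (ω t).1 = C.outLoc := by rw [hω.eq_of_out hi hit, hi]
  have hmem : (ω t).2 ∈ I C.outLoc := ht ▸ hI _ (hω.reachable t)
  rw [proc, hω.output_eq ht, ht, hout _ hmem, zero_add]

theorem ASTerminating.tendsto_integral_proc (hterm : C.ASTerminating) (hI : C.IsInvariant I)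
    (hη : C.IsStateFunction η) (hf : Measurable f) (hout : ∀ x ∈ I C.outLoc, η C.outLoc x = 0)
    (hmaj : HasIntegrableMajorant (C.proc η f) C.pathMeasure) :
    Tendsto (fun t => ∫ ω, C.proc η f t ω ∂C.pathMeasure) atTop
      (nhds (∫ y, f y ∂C.outputDist)) := by
  rw [hterm.outputDist_eq_map,
    integral_map C.measurable_output.aemeasurable hf.aestronglyMeasurable]
  exact hmaj.tendsto_integral (fun t => (hη.measurable_proc hf t).aestronglyMeasurable)
    (hterm.ae_tendsto_proc hI hout)

theorem IsUESM.integral_outputDist_le (h : C.IsUESM I f η) (hI : C.IsInvariant I)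
    (hf : Measurable f) (hterm : C.ASTerminating)
    (hmaj : HasIntegrableMajorant (C.proc η f) C.pathMeasure) :
    ∫ y, f y ∂C.outputDist ≤ η C.initLoc C.initVal + f (C.out C.initVal) := by
  have hint (i : ℕ) : Integrable (C.proc η f i) C.pathMeasure :=
    hmaj.integrable (h.isStateFunction.measurable_proc hf i).aestronglyMeasurable
  rw [← integral_proc_zero]
  exact (h.antitone_integral_proc hI hf hint).le_of_tendsto
    (hterm.tendsto_integral_proc hI h.isStateFunction hf h.zero_on_output hmaj) 0

theorem IsLESM.le_integral_outputDist (h : C.IsLESM I f η) (hI : C.IsInvariant I)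
    (hf : Measurable f) (hterm : C.ASTerminating)
    (hmaj : HasIntegrableMajorant (C.proc η f) C.pathMeasure) :
    η C.initLoc C.initVal + f (C.out C.initVal) ≤ ∫ y, f y ∂C.outputDist := by
  have hint (i : ℕ) : Integrable (C.proc η f i) C.pathMeasure :=
    hmaj.integrable (h.isStateFunction.measurable_proc hf i).aestronglyMeasurable
  rw [← integral_proc_zero]
  exact (h.monotone_integral_proc hI hf hint).ge_of_tendsto
    (hterm.tendsto_integral_proc hI h.isStateFunction hf h.zero_on_output hmaj) 0

end OptionalStopping

end PCFG

namespace IsOneLipschitz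

variable {X : Type} [MeasurableSpace X] {d : X → X → ℝ} {g : X → ℝ} {μ ν : Measure X}

theorem lintegral_enorm_sub_le (hg : IsOneLipschitz d g) (a : X) :
    ∫⁻ x, ‖g x - g a‖ₑ ∂μ ≤ ∫⁻ x, ENNReal.ofReal (d a x) ∂μ := by
  refine lintegral_mono fun x => ?_
  rw [Real.enorm_eq_ofReal_abs, abs_sub_comm]
  exact ENNReal.ofReal_le_ofReal (hg a x)

theorem integrable [IsFiniteMeasure μ] (hg : IsOneLipschitz d g) (hgm : Measurable g)
    (hμ : HasFiniteFirstMoment d μ) : Integrable g μ := by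
  obtain ⟨a, ha⟩ := hμ
  have hsub : Integrable (fun x => g x - g a) μ :=
    ⟨(hgm.sub_const _).aestronglyMeasurable, (hg.lintegral_enorm_sub_le a).trans_lt ha⟩
  simpa only [Pi.add_def, sub_add_cancel] using hsub.add (integrable_const (g a))

theorem abs_integral_sub_le [IsProbabilityMeasure μ] (hg : IsOneLipschitz d g)
    (hgm : Measurable g) {a : X} (ha : ∫⁻ x, ENNReal.ofReal (d a x) ∂μ < ⊤) :
    |∫ x, g x ∂μ - g a| ≤ (∫⁻ x, ENNReal.ofReal (d a x) ∂μ).toReal := by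
  calc |∫ x, g x ∂μ - g a| = ‖∫ x, (g x - g a) ∂μ‖ := by
        rw [integral_sub (hg.integrable hgm ⟨a, ha⟩) (integrable_const _), integral_const,
          probReal_univ, one_smul, Real.norm_eq_abs]
    _ ≤ (∫⁻ x, ENNReal.ofReal ‖g x - g a‖ ∂μ).toReal := norm_integral_le_lintegral_norm _
    _ ≤ (∫⁻ x, ENNReal.ofReal (d a x) ∂μ).toReal := by
        refine ENNReal.toReal_mono ha.ne ?_
        simpa only [ofReal_norm] using hg.lintegral_enorm_sub_le a

theorem abs_integral_sub_integral_le_kantorovich [IsProbabilityMeasure μ] [IsProbabilityMeasure ν]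
    (hg : IsOneLipschitz d g) (hgm : Measurable g) (hμ : HasFiniteFirstMoment d μ)
    (hν : HasFiniteFirstMoment d ν) : |∫ x, g x ∂μ - ∫ x, g x ∂ν| ≤ kantorovich d μ ν := by
  obtain ⟨a, ha⟩ := hμ
  obtain ⟨b, hb⟩ := hν
  refine le_csSup ⟨(∫⁻ x, ENNReal.ofReal (d a x) ∂μ).toReal + d a b
    + (∫⁻ x, ENNReal.ofReal (d b x) ∂ν).toReal, ?_⟩ ⟨g, hgm, hg, rfl⟩
  rintro _ ⟨k, hkm, hk, rfl⟩
  have hka := hk.abs_integral_sub_le hkm ha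
  have hkb := hk.abs_integral_sub_le hkm hb
  rw [abs_sub_comm] at hkb
  calc |∫ x, k x ∂μ - ∫ x, k x ∂ν|
      ≤ |∫ x, k x ∂μ - k a| + |k a - k b| + |k b - ∫ x, k x ∂ν| :=
        (abs_sub_le _ (k b) _).trans (add_le_add_left (abs_sub_le _ (k a) _) _)
    _ ≤ _ := add_le_add (add_le_add hka (hk a b)) hkb

end IsOneLipschitz

theorem theorem2_general {m : ℕ} (C₁ C₂ : PCFG m)
    (hterm₁ : C₁.ASTerminating) (hterm₂ : C₂.ASTerminating)
    (f : (Fin m → ℝ) → ℝ) (hf : Measurable f)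
    (I₁ : C₁.Loc → Set C₁.Val) (hI₁ : C₁.IsInvariant I₁)
    (I₂ : C₂.Loc → Set C₂.Val) (hI₂ : C₂.IsInvariant I₂)
    (U : C₁.Loc → C₁.Val → ℝ) (hU : C₁.IsUESM I₁ f U)
    (hUmaj : HasIntegrableMajorant (C₁.proc U f) C₁.pathMeasure)
    (L : C₂.Loc → C₂.Val → ℝ) (hL : C₂.IsLESM I₂ f L)
    (hLmaj : HasIntegrableMajorant (C₂.proc L f) C₂.pathMeasure)
    (hlt : U C₁.initLoc C₁.initVal + f (C₁.out C₁.initVal)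
      < L C₂.initLoc C₂.initVal + f (C₂.out C₂.initVal)) :
    ¬ OutputEquivalent C₁ C₂ ∧
    ∀ d : (Fin m → ℝ) → (Fin m → ℝ) → ℝ,
      HasFiniteFirstMoment d C₁.outputDist → HasFiniteFirstMoment d C₂.outputDist →
      IsOneLipschitz d f →
      kantorovich d C₁.outputDist C₂.outputDist
        ≥ L C₂.initLoc C₂.initVal + f (C₂.out C₂.initVal)
          - U C₁.initLoc C₁.initVal - f (C₁.out C₁.initVal) := by
  have hle₁ := hU.integral_outputDist_le hI₁ hf hterm₁ hUmaj
  have hle₂ := hL.le_integral_outputDist hI₂ hf hterm₂ hLmaj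
  have := hterm₁.isProbabilityMeasure_outputDist
  have := hterm₂.isProbabilityMeasure_outputDist
  refine ⟨fun heq => ?_, fun d hd₁ hd₂ hlip => ?_⟩
  · rw [Measure.ext heq] at hle₁
    linarith
  · have hK := hlip.abs_integral_sub_integral_le_kantorovich hf hd₁ hd₂
    have hgap := neg_abs_le (∫ y, f y ∂C₁.outputDist - ∫ y, f y ∂C₂.outputDist)
    linarith

theorem theorem2 {m : ℕ} (C₁ C₂ : PCFG m)
    (hterm₁ : C₁.ASTerminating) (hterm₂ : C₂.ASTerminating)
    (f : (Fin m → ℝ) → ℝ) (hf : Measurable f)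
    (I₁ : C₁.Loc → Set C₁.Val) (hI₁ : C₁.IsInvariant I₁)
    (I₂ : C₂.Loc → Set C₂.Val) (hI₂ : C₂.IsInvariant I₂)
    (U : C₁.Loc → C₁.Val → ℝ) (hU : C₁.IsUESM I₁ f U) (hUost : C₁.OSTSound U f)
    (L : C₂.Loc → C₂.Val → ℝ) (hL : C₂.IsLESM I₂ f L) (hLost : C₂.OSTSound L f)
    (hlt : U C₁.initLoc C₁.initVal + f (C₁.out C₁.initVal)
      < L C₂.initLoc C₂.initVal + f (C₂.out C₂.initVal)) :
    ¬ OutputEquivalent C₁ C₂ ∧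
    ∀ d : (Fin m → ℝ) → (Fin m → ℝ) → ℝ, IsMetric d →
      HasFiniteFirstMoment d C₁.outputDist → HasFiniteFirstMoment d C₂.outputDist →
      IsOneLipschitz d f →
      kantorovich d C₁.outputDist C₂.outputDist
        ≥ L C₂.initLoc C₂.initVal + f (C₂.out C₂.initVal)
          - U C₁.initLoc C₁.initVal - f (C₁.out C₁.initVal) := by
  obtain ⟨hne, hK⟩ := theorem2_general C₁ C₂ hterm₁ hterm₂ f hf I₁ hI₁ I₂ hI₂
    U hU hUost.hasIntegrableMajorant L hL hLost.hasIntegrableMajorant hlt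
  exact ⟨hne, fun d _ => hK d⟩
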